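/- **Free Universal Monodromy theorem.** Let $R_1, R_2$ be topological vector spaces over $\mathbb{C}$, where the continuous linear functionals on $R_2$ separate its points (e.g. $R_2$ Hausdorff and locally convex). Let $\mathcal{M}(R)=\bigcup_{n\ge 1} M_n(\mathbb{C})\otimes R$, and for $D\subseteq\mathcal{M}(R)$ put $D_n=D\cap (M_n(\mathbb{C})\otimes R)$. A *free set* is a set $D\subseteq \mathcal{M}(R)$ such that $X\oplus Y\in D$ for $X,Y\in D$, and $V^*XV\in D$ for $X\in D$ and $V$ unitary of the same size; it is *open* if every $D_n$ is open, and *connected* if any two points of a common level $D_n$ are joined by a path in $D_n$ (levels may be empty). A *free analytic function* on an open free set $D\subseteq\mathcal{M}(R_1)$ is a map $f:D\to\mathcal{M}(R_2)$ with $f(D_n)\subseteq M_n(\mathbb{C})\otimes R_2$, $f(X\oplus Y)=f(X)\oplus f(Y)$, $f(V^*XV)=V^*f(X)V$ for unitary $V$, and with every $f_n=f|_{D_n}$ analytic, i.e. continuous and given near each point by a convergent series of continuous homogeneous polynomials. An *analytic continuation* of $f$ along a path $\gamma:[0,1]\to M_n(\mathbb{C})\otimes R_1$ with $\gamma(0)$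 in the domain of $f$ is a family $(G_t)_{t\in[0,1]}$ of functions, $G_t$ analytic near $\gamma(t)$, such that $G_0=f_n$ near $\gamma(0)$ and, for each $t$ and all $s$ sufficiently near $t$, $G_s=G_t$ near $\gamma(s)$. Let $\mathcal{D}\subseteq\mathcal{M}(R_1)$ be an open connected free set, $B\subseteq\mathcal{D}$ a nonempty open free set, and $f$ a free analytic function on $B$. Then the following are equivalent: 1. for every $n$, $f$ has an analytic continuation along every path in $\mathcal{D}_n$ that starts in $B_n$; 2. there is a free analytic function $F$ on $\mathcal{D}$ with $F|_B=f$ which moreover is the unique free analytic function on $\mathcal{D}$ extending $f$, and is such that for every $n$ and every analytic continuation $(G_t)$ of $f$ along any path $\gamma$ in $\mathcal{D}_n$ starting in $B_n$, $G_t=F_n$ near $\gamma(t)$ for all $t\in[0,1]$ (so the continuation is single-valued). No simple connectivity of $\mathcal{D}$ is assumed. -/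

import Mathlib

open Filter Topology

/-- Level `n ≥ 1` of the matrix universe over `R`: the space `M_n(ℂ) ⊗ R`, that is, `n × n`
matrices with entries in `R`, with the entrywise (product) topology. -/
abbrev MatLevel (R : Type*) (n : ℕ+) : Type _ := Matrix (Fin n) (Fin n) R

/-- The direct sum `X ⊕ Y = [[X, 0], [0, Y]]`. -/
def dirSum {R : Type*} [Zero R] {n m : ℕ+} (X : MatLevel R n) (Y : MatLevel R m) :
    MatLevel R (n + m) :=
  Matrix.reindex finSumFinEquiv finSumFinEquiv (Matrix.fromBlocks X 0 0 Y)

/-- The conjugation `V^* X V` of an `R`-valued matrix by a complex matrix: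
`(V^* X V) i j = ∑ k l, conj (V k i) * V l j • X k l`. -/
def starConj {R : Type*} [AddCommGroup R] [Module ℂ R] {n : ℕ+}
    (V : MatLevel ℂ n) (X : MatLevel R n) : MatLevel R n :=
  Matrix.of fun i j => ∑ k, ∑ l, (star (V k i) * V l j) • X k l

/-- A free set, given by its levels `D n = D ∩ M_n(ℂ) ⊗ R`: closed under direct sums and under
conjugation by unitaries. -/
structure IsFreeSet {R : Type*} [AddCommGroup R] [Module ℂ R]
    (D : ∀ n : ℕ+, Set (MatLevel R n)) : Prop where
  dirSum_mem : ∀ {n m : ℕ+} {X : MatLevel R n} {Y : MatLevel R m},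
    X ∈ D n → Y ∈ D m → dirSum X Y ∈ D (n + m)
  starConj_mem : ∀ {n : ℕ+} {X : MatLevel R n} {V : MatLevel ℂ n},
    X ∈ D n → V ∈ Matrix.unitaryGroup (Fin n) ℂ → starConj V X ∈ D n

/-- A free set is open if each of its levels is open. -/
def IsOpenFree {R : Type*} [TopologicalSpace R] (D : ∀ n : ℕ+, Set (MatLevel R n)) : Prop :=
  ∀ n, IsOpen (D n)

/-- A free set is connected if each of its levels is path connected (levels may be empty). -/
def IsConnectedFree {R : Type*} [TopologicalSpace R] (D : ∀ n : ℕ+, Set (MatLevel R n)) : Prop :=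
  ∀ n, ∀ X ∈ D n, ∀ Y ∈ D n, JoinedIn (D n) X Y

/-- Complex analyticity on a (typically open) set for maps between complex topological vector
spaces: `f` is continuous and near every point of the set it is the sum of a power series, i.e.
of a series of continuous homogeneous polynomials `h ↦ p k (h, …, h)`. -/
def IsAnalyticMapOn {E F : Type*}
    [AddCommGroup E] [Module ℂ E] [TopologicalSpace E] [IsTopologicalAddGroup E]
    [ContinuousSMul ℂ E]
    [AddCommGroup F] [Module ℂ F] [TopologicalSpace F] [IsTopologicalAddGroup F]
    [ContinuousSMul ℂ F] (f : E → F) (U : Set E) : Prop :=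
  ContinuousOn f U ∧
    ∀ x ∈ U, ∃ p : FormalMultilinearSeries ℂ E F,
      ∀ᶠ h in 𝓝 (0 : E), HasSum (fun k => p k fun _ => h) (f (x + h))

/-- `f` (considered on `D`) is a free function that is analytic on each level: it is graded,
respects direct sums and unitary conjugation, and each `f n` is analytic on `D n`. -/
structure IsFreeAnalyticOn {R₁ R₂ : Type*}
    [AddCommGroup R₁] [Module ℂ R₁] [TopologicalSpace R₁] [IsTopologicalAddGroup R₁]
    [ContinuousSMul ℂ R₁]
    [AddCommGroup R₂] [Module ℂ R₂] [TopologicalSpace R₂] [IsTopologicalAddGroup R₂]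
    [ContinuousSMul ℂ R₂]
    (f : ∀ n : ℕ+, MatLevel R₁ n → MatLevel R₂ n) (D : ∀ n : ℕ+, Set (MatLevel R₁ n)) :
    Prop where
  map_dirSum : ∀ {n m : ℕ+} {X : MatLevel R₁ n} {Y : MatLevel R₁ m},
    X ∈ D n → Y ∈ D m → f (n + m) (dirSum X Y) = dirSum (f n X) (f m Y)
  map_starConj : ∀ {n : ℕ+} {X : MatLevel R₁ n} {V : MatLevel ℂ n},
    X ∈ D n → V ∈ Matrix.unitaryGroup (Fin n) ℂ →
      f n (starConj V X) = starConj V (f n X)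
  analytic : ∀ n, IsAnalyticMapOn (f n) (D n)

/-- `G` is an analytic continuation of `f` along the path `γ`: each `G t` is analytic near `γ t`,
`G 0` and `f` have the same germ at `γ 0`, and for `s` near `t` the functions `G s` and `G t`
have the same germ at `γ s`. -/
structure IsContinuationAlong {E F : Type*}
    [AddCommGroup E] [Module ℂ E] [TopologicalSpace E] [IsTopologicalAddGroup E]
    [ContinuousSMul ℂ E]
    [AddCommGroup F] [Module ℂ F] [TopologicalSpace F] [IsTopologicalAddGroup F]
    [ContinuousSMul ℂ F]
    (f : E → F) (γ : C(unitInterval, E)) (G : unitInterval → E → F) : Prop where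
  analytic : ∀ t, ∃ U : Set E, IsOpen U ∧ γ t ∈ U ∧ IsAnalyticMapOn (G t) U
  start : G 0 =ᶠ[𝓝 (γ 0)] f
  compatible : ∀ t, ∀ᶠ s in 𝓝 t, G s =ᶠ[𝓝 (γ s)] G t

/-! Direct sums do the work that simple connectivity does classically. Let `f` continue along `γ₁`
and `γ₂`, with final points `Z`, `Z'` and final values `P`, `P'`, and let a partial isometry `T`
satisfy `Z T = T Z'` and `T* Z = Z' T*`. The path `γ₁ ⊕ γ₂` starts in `B`, so `f` continues along it
too. By permanence of functional equations, the final germ takes the value `P ⊕ P'` at `Z ⊕ Z'` and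
is equivariant there under unitaries close to `1`. The rotations generated by the skew-adjoint
matrix with off-diagonal blocks `T` and `-T*` fix `Z ⊕ Z'`, hence a small one fixes `P ⊕ P'`, and
its off-diagonal corner reads `P T = T P'` (`IsContinuedValue.intertwines`). For `Z = Z'` and `T =
1` this is monodromy.

Some levels of `B` may be empty. Each `X` in `D` nevertheless has a `Y` in `D` such that `X ⊕ Y`
lies on a level that meets `B`, and the value at `X` is defined as the corner of a continued value
at `X ⊕ Y`. The intertwining relation passes to such compressions (`IsCompressedValue.intertwines`).
Different choices of `T` then give independence of choices, compatibility with direct sums and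
unitary equivariance. Uniqueness of `F` holds because every free extension takes these values.

Permanence (`eventuallyEq_along_path`) rests on the one-variable identity theorem, applied along
segments after composing with functionals that separate points. -/

set_option linter.unusedSectionVars false

/-! ### Two-sided multiplication of `R`-valued matrices by complex matrices. -/

section Sandwich

variable {R : Type*} [AddCommGroup R] [Module ℂ R]
variable {a b c d e g : Type*} [Fintype b] [Fintype c]

/-- The product `A X B` of an `R`-valued matrix `X` with complex matrices `A` and `B`. -/
def sandwich (A : Matrix a b ℂ) (X : Matrix b c R) (B : Matrix c d ℂ) : Matrix a d R :=
  Matrix.of fun i j => ∑ k, ∑ l, (A i k * B l j) • X k l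

theorem sandwich_add (A : Matrix a b ℂ) (X Y : Matrix b c R) (B : Matrix c d ℂ) :
    sandwich A (X + Y) B = sandwich A X B + sandwich A Y B := by
  ext i j; simp [sandwich, Finset.sum_add_distrib]

theorem sandwich_smul (r : ℂ) (A : Matrix a b ℂ) (X : Matrix b c R) (B : Matrix c d ℂ) :
    sandwich A (r • X) B = r • sandwich A X B := by
  ext i j; simp [sandwich, Finset.smul_sum, smul_comm r]

theorem add_sandwich (A A' : Matrix a b ℂ) (X : Matrix b c R) (B : Matrix c d ℂ) :
    sandwich (A + A') X B = sandwich A X B + sandwich A' X B := by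
  ext i j; simp [sandwich, Finset.sum_add_distrib, add_mul, add_smul]

theorem sandwich_add_right (A : Matrix a b ℂ) (X : Matrix b c R) (B B' : Matrix c d ℂ) :
    sandwich A X (B + B') = sandwich A X B + sandwich A X B' := by
  ext i j; simp [sandwich, Finset.sum_add_distrib, mul_add, add_smul]

theorem smul_sandwich (r : ℂ) (A : Matrix a b ℂ) (X : Matrix b c R) (B : Matrix c d ℂ) :
    sandwich (r • A) X B = r • sandwich A X B := by
  ext i j; simp [sandwich, Finset.smul_sum, mul_assoc, mul_smul]

theorem sandwich_smul_right (r : ℂ) (A : Matrix a b ℂ) (X : Matrix b c R) (B : Matrix c d ℂ) :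
    sandwich A X (r • B) = r • sandwich A X B := by
  ext i j; simp [sandwich, Finset.smul_sum, mul_left_comm _ r, mul_smul]

theorem neg_sandwich (A : Matrix a b ℂ) (X : Matrix b c R) (B : Matrix c d ℂ) :
    sandwich (-A) X B = -sandwich A X B := by
  ext i j; simp [sandwich]

theorem sandwich_neg_right (A : Matrix a b ℂ) (X : Matrix b c R) (B : Matrix c d ℂ) :
    sandwich A X (-B) = -sandwich A X B := by
  ext i j; simp [sandwich]

theorem zero_sandwich (X : Matrix b c R) (B : Matrix c d ℂ) :
    sandwich (0 : Matrix a b ℂ) X B = 0 := by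
  ext i j; simp [sandwich]

theorem sandwich_zero_right (A : Matrix a b ℂ) (X : Matrix b c R) :
    sandwich A X (0 : Matrix c d ℂ) = 0 := by
  ext i j; simp [sandwich]

theorem one_sandwich_one [DecidableEq b] [DecidableEq c] (X : Matrix b c R) :
    sandwich (1 : Matrix b b ℂ) X (1 : Matrix c c ℂ) = X := by
  ext i j
  simp [sandwich, Matrix.one_apply, ite_smul]

theorem sandwich_sandwich [Fintype a] [Fintype d] (A' : Matrix e a ℂ) (A : Matrix a b ℂ) (X : Matrix b c R)
    (B : Matrix c d ℂ) (B' : Matrix d g ℂ) :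
    sandwich A' (sandwich A X B) B' = sandwich (A' * A) X (B * B') := by
  ext i j
  simp only [sandwich, Matrix.of_apply, Finset.smul_sum, Matrix.mul_apply, smul_smul,
    Finset.sum_mul_sum, Finset.sum_smul]
  calc _ = ∑ k', ∑ k, ∑ l', ∑ l, (A' i k' * B' l' j * (A k' k * B l l')) • X k l :=
        Finset.sum_congr rfl fun k' _ => Finset.sum_comm
    _ = ∑ k, ∑ k', ∑ l, ∑ l', (A' i k' * B' l' j * (A k' k * B l l')) • X k l := by
        rw [Finset.sum_comm]
        exact Finset.sum_congr rfl fun k _ => Finset.sum_congr rfl fun k' _ => Finset.sum_comm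
    _ = ∑ k, ∑ l, ∑ k', ∑ l', (A' i k' * B' l' j * (A k' k * B l l')) • X k l :=
        Finset.sum_congr rfl fun k _ => Finset.sum_comm
    _ = _ := by
        refine Finset.sum_congr rfl fun k _ => Finset.sum_congr rfl fun l _ =>
          Finset.sum_congr rfl fun k' _ => Finset.sum_congr rfl fun l' _ => ?_
        congr 1; ring

variable [TopologicalSpace R] [IsTopologicalAddGroup R] [ContinuousSMul ℂ R]

theorem continuous_sandwich (A : Matrix a b ℂ) (B : Matrix c d ℂ) :
    Continuous fun X : Matrix b c R => sandwich A X B := by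
  refine continuous_matrix fun i j => ?_
  refine continuous_finsetSum _ fun k _ => continuous_finsetSum _ fun l _ => ?_
  exact (continuous_id.matrix_elem k l).const_smul (A i k * B l j)

/-- `X ↦ A X B` as a continuous linear map. -/
def sandwichCLM (A : Matrix a b ℂ) (B : Matrix c d ℂ) : Matrix b c R →L[ℂ] Matrix a d R where
  toFun X := sandwich A X B
  map_add' X Y := sandwich_add A X Y B
  map_smul' r X := sandwich_smul r A X B
  cont := continuous_sandwich A B

end Sandwich

/-! ### Block matrices and the unitary rotations attached to a partial isometry. -/

section Blocks

open Matrix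

variable {R : Type*} [AddCommGroup R] [Module ℂ R]
variable {a b c : Type*} [Fintype a] [Fintype b] [Fintype c] [DecidableEq a] [DecidableEq b]
  [DecidableEq c] (e : a ⊕ b ≃ c)

/-- The isometry `ℂᵃ → ℂᶜ` onto the first coordinates of `c ≃ a ⊕ b`. -/
def inclLeft : Matrix c a ℂ := (1 : Matrix c c ℂ).submatrix id fun i => e (Sum.inl i)

/-- The isometry `ℂᵇ → ℂᶜ` onto the last coordinates of `c ≃ a ⊕ b`. -/
def inclRight : Matrix c b ℂ := (1 : Matrix c c ℂ).submatrix id fun i => e (Sum.inr i)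

/-- The block diagonal matrix with blocks `X` and `Y`. -/
def blockSum (X : Matrix a a R) (Y : Matrix b b R) : Matrix c c R :=
  Matrix.reindex e e (Matrix.fromBlocks X 0 0 Y)

theorem inclLeft_star_mul_inclLeft : (inclLeft e)ᴴ * inclLeft e = 1 := by
  ext i j; simp [inclLeft, Matrix.mul_apply, Matrix.one_apply]

theorem inclRight_star_mul_inclRight : (inclRight e)ᴴ * inclRight e = 1 := by
  ext i j; simp [inclRight, Matrix.mul_apply, Matrix.one_apply]

theorem inclLeft_star_mul_inclRight : (inclLeft e)ᴴ * inclRight e = 0 := by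
  ext i j; simp [inclLeft, inclRight, Matrix.mul_apply, Matrix.one_apply]

theorem inclRight_star_mul_inclLeft : (inclRight e)ᴴ * inclLeft e = 0 := by
  ext i j; simp [inclLeft, inclRight, Matrix.mul_apply, Matrix.one_apply]

theorem blockSum_eq_sandwich (X : Matrix a a R) (Y : Matrix b b R) :
    blockSum e X Y = sandwich (inclLeft e) X (inclLeft e)ᴴ +
      sandwich (inclRight e) Y (inclRight e)ᴴ := by
  ext i j
  obtain ⟨i, rfl⟩ := e.surjective i
  obtain ⟨j, rfl⟩ := e.surjective j
  rcases i with i | i <;> rcases j with j | j <;>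
    simp [blockSum, sandwich, inclLeft, inclRight, Matrix.one_apply, ite_smul]

theorem inclLeft_star_sandwich_blockSum {d : Type*} [Fintype d] (X : Matrix a a R)
    (Y : Matrix b b R) (C : Matrix c d ℂ) :
    sandwich (inclLeft e)ᴴ (blockSum e X Y) C = sandwich 1 X ((inclLeft e)ᴴ * C) := by
  rw [blockSum_eq_sandwich, sandwich_add, sandwich_sandwich, sandwich_sandwich,
    inclLeft_star_mul_inclLeft, inclLeft_star_mul_inclRight, zero_sandwich, add_zero]

theorem inclRight_star_sandwich_blockSum {d : Type*} [Fintype d] (X : Matrix a a R)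
    (Y : Matrix b b R) (C : Matrix c d ℂ) :
    sandwich (inclRight e)ᴴ (blockSum e X Y) C = sandwich 1 Y ((inclRight e)ᴴ * C) := by
  rw [blockSum_eq_sandwich, sandwich_add, sandwich_sandwich, sandwich_sandwich,
    inclRight_star_mul_inclRight, inclRight_star_mul_inclLeft, zero_sandwich, zero_add]

theorem blockSum_sandwich_inclLeft {d : Type*} [Fintype d] (X : Matrix a a R)
    (Y : Matrix b b R) (C : Matrix d c ℂ) :
    sandwich C (blockSum e X Y) (inclLeft e) = sandwich (C * inclLeft e) X 1 := by
  rw [blockSum_eq_sandwich, sandwich_add, sandwich_sandwich, sandwich_sandwich,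
    inclLeft_star_mul_inclLeft, inclRight_star_mul_inclLeft, sandwich_zero_right, add_zero]

theorem blockSum_sandwich_inclRight {d : Type*} [Fintype d] (X : Matrix a a R)
    (Y : Matrix b b R) (C : Matrix d c ℂ) :
    sandwich C (blockSum e X Y) (inclRight e) = sandwich (C * inclRight e) Y 1 := by
  rw [blockSum_eq_sandwich, sandwich_add, sandwich_sandwich, sandwich_sandwich,
    inclRight_star_mul_inclRight, inclLeft_star_mul_inclRight, sandwich_zero_right, zero_add]

/-- The skew-adjoint matrix with off-diagonal blocks `T` and `-T*`. -/
def offDiag (T : Matrix a b ℂ) : Matrix c c ℂ :=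
  inclLeft e * T * (inclRight e)ᴴ - inclRight e * Tᴴ * (inclLeft e)ᴴ

theorem offDiag_mul_inclLeft (T : Matrix a b ℂ) :
    offDiag e T * inclLeft e = -(inclRight e * Tᴴ) := by
  simp [offDiag, Matrix.sub_mul, Matrix.mul_assoc, inclLeft_star_mul_inclLeft,
    inclRight_star_mul_inclLeft]

theorem offDiag_mul_inclRight (T : Matrix a b ℂ) :
    offDiag e T * inclRight e = inclLeft e * T := by
  simp [offDiag, Matrix.sub_mul, Matrix.mul_assoc, inclLeft_star_mul_inclRight,
    inclRight_star_mul_inclRight]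

theorem inclLeft_star_mul_offDiag (T : Matrix a b ℂ) :
    (inclLeft e)ᴴ * offDiag e T = T * (inclRight e)ᴴ := by
  simp [offDiag, Matrix.mul_sub, ← Matrix.mul_assoc, inclLeft_star_mul_inclLeft,
    inclLeft_star_mul_inclRight]

theorem inclRight_star_mul_offDiag (T : Matrix a b ℂ) :
    (inclRight e)ᴴ * offDiag e T = -(Tᴴ * (inclLeft e)ᴴ) := by
  simp [offDiag, Matrix.mul_sub, ← Matrix.mul_assoc, inclRight_star_mul_inclLeft,
    inclRight_star_mul_inclRight]

theorem offDiag_conjTranspose (T : Matrix a b ℂ) : (offDiag e T)ᴴ = -offDiag e T := by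
  simp [offDiag, Matrix.conjTranspose_mul, Matrix.mul_assoc]

/-- For a partial isometry the square is minus the block diagonal projection `T T* ⊕ T* T`, which
acts as the identity on the range. The exponential series therefore closes up after the quadratic
term, which gives the formula in `blockRotation`. -/
theorem offDiag_cube {T : Matrix a b ℂ} (hT : T * Tᴴ * T = T) :
    offDiag e T * (offDiag e T * offDiag e T) = -offDiag e T := by
  have hT' : Tᴴ * (T * Tᴴ) = Tᴴ := by
    simpa [Matrix.conjTranspose_mul, Matrix.mul_assoc] using congrArg Matrix.conjTranspose hT
  have h : offDiag e T * offDiag e T =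
      -(inclLeft e * (T * Tᴴ) * (inclLeft e)ᴴ) - inclRight e * (Tᴴ * T) * (inclRight e)ᴴ := by
    conv_lhs => enter [2]; rw [offDiag]
    rw [Matrix.mul_sub, ← Matrix.mul_assoc, ← Matrix.mul_assoc, offDiag_mul_inclLeft,
      ← Matrix.mul_assoc, ← Matrix.mul_assoc, offDiag_mul_inclRight]
    simp only [Matrix.neg_mul, Matrix.mul_assoc]
    abel
  rw [h, Matrix.mul_sub, Matrix.mul_neg, ← Matrix.mul_assoc, ← Matrix.mul_assoc,
    offDiag_mul_inclLeft, ← Matrix.mul_assoc (offDiag e T), ← Matrix.mul_assoc (offDiag e T),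
    offDiag_mul_inclRight, Matrix.neg_mul, Matrix.mul_assoc (inclRight e), hT', Matrix.mul_assoc (inclLeft e),
    ← Matrix.mul_assoc T, hT, offDiag]
  simp only [Matrix.neg_mul]
  abel

/-- The rotation `exp (θ A)`, where `A` is the skew-adjoint matrix with off-diagonal blocks `T`
and `-T*` and `T` is a partial isometry. -/
noncomputable def blockRotation (T : Matrix a b ℂ) (θ : ℝ) : Matrix c c ℂ :=
  1 + (Real.sin θ : ℂ) • offDiag e T + (1 - Real.cos θ : ℂ) • (offDiag e T * offDiag e T)

theorem blockRotation_mem_unitary {T : Matrix a b ℂ} (hT : T * Tᴴ * T = T) (θ : ℝ) :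
    blockRotation e T θ ∈ Matrix.unitaryGroup c ℂ := by
  rw [Matrix.mem_unitaryGroup_iff', Matrix.star_eq_conjTranspose]
  have h3 := offDiag_cube e hT
  have hstar : (blockRotation e T θ)ᴴ = 1 - (Real.sin θ : ℂ) • offDiag e T +
      (1 - Real.cos θ : ℂ) • (offDiag e T * offDiag e T) := by
    have hc : (starRingEnd ℂ) (1 - Real.cos θ : ℂ) = 1 - Real.cos θ := by
      rw [map_sub, map_one, Complex.conj_ofReal]
    rw [blockRotation]
    simp only [hc, Matrix.conjTranspose_add, Matrix.conjTranspose_one, Matrix.conjTranspose_smul,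
      Matrix.conjTranspose_mul, offDiag_conjTranspose, Complex.star_def, Complex.conj_ofReal,
      neg_mul_neg, smul_neg]
    abel
  rw [hstar, blockRotation]
  have h4 : offDiag e T * offDiag e T * (offDiag e T * offDiag e T) =
      -(offDiag e T * offDiag e T) := by
    rw [mul_assoc, h3, mul_neg]
  have h3' : offDiag e T * offDiag e T * offDiag e T = -offDiag e T := by rw [mul_assoc, h3]
  have hcs : (Real.sin θ : ℂ) * Real.sin θ = 1 - Real.cos θ * Real.cos θ := by
    have := Real.sin_sq_add_cos_sq θ
    rw [eq_sub_iff_add_eq]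
    exact_mod_cast (by linarith [sq (Real.sin θ), sq (Real.cos θ)] :
      Real.sin θ * Real.sin θ + Real.cos θ * Real.cos θ = 1)
  simp only [add_mul, mul_add, sub_mul, one_mul, mul_one, smul_mul_assoc, mul_smul_comm,
    h3, h3', h4]
  -- This is everything beyond `1` in the product: with `c = 1 - cos θ` the coefficient of the
  -- square is `2c - c² - sin² θ`.
  have hz : (1 - Real.cos θ * Real.cos θ - Real.sin θ * Real.sin θ : ℂ) •
      (offDiag e T * offDiag e T) = 0 := by rw [hcs, sub_self, zero_smul]
  rw [← sub_eq_zero, ← hz]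
  module

theorem continuous_blockRotation (T : Matrix a b ℂ) : Continuous (blockRotation e T) := by
  unfold blockRotation
  have h₁ : Continuous fun θ : ℝ => (Real.sin θ : ℂ) :=
    Complex.continuous_ofReal.comp Real.continuous_sin
  have h₂ : Continuous fun θ : ℝ => (1 - Real.cos θ : ℂ) :=
    continuous_const.sub (Complex.continuous_ofReal.comp Real.continuous_cos)
  exact (continuous_const.add (h₁.smul continuous_const)).add (h₂.smul continuous_const)

theorem blockRotation_zero (T : Matrix a b ℂ) : blockRotation e T 0 = 1 := by
  simp [blockRotation]

/-- The identity and the square of `offDiag e T` are block diagonal, so only the sine term reaches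
the corner. -/
theorem inclLeft_star_blockRotation_inclRight (T : Matrix a b ℂ) (θ : ℝ) :
    (inclLeft e)ᴴ * blockRotation e T θ * inclRight e = (Real.sin θ : ℂ) • T := by
  have h : (inclLeft e)ᴴ * (offDiag e T * (offDiag e T * inclRight e)) = 0 := by
    rw [offDiag_mul_inclRight, ← Matrix.mul_assoc (offDiag e T), offDiag_mul_inclLeft,
      Matrix.neg_mul, Matrix.mul_neg, Matrix.mul_assoc, ← Matrix.mul_assoc,
      inclLeft_star_mul_inclRight, Matrix.zero_mul, neg_zero]
  rw [Matrix.mul_assoc, blockRotation]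
  simp only [Matrix.add_mul, Matrix.one_mul, Matrix.smul_mul, Matrix.mul_add, Matrix.mul_smul,
    Matrix.mul_assoc, h, smul_zero, add_zero, inclLeft_star_mul_inclRight, zero_add]
  rw [offDiag_mul_inclRight, ← Matrix.mul_assoc, inclLeft_star_mul_inclLeft, Matrix.one_mul]

/-- `Z` and `Z'` are intertwined by `T` and `T*`. -/
def Intertwines (Z : Matrix a a R) (T : Matrix a b ℂ) (Z' : Matrix b b R) : Prop :=
  sandwich 1 Z T = sandwich T Z' 1 ∧ sandwich Tᴴ Z 1 = sandwich 1 Z' Tᴴ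

/-- Each of the two intertwining relations accounts for one off-diagonal block. As `R` has no
involution, the relation for `T*` cannot be deduced from the one for `T`. -/
theorem Intertwines.offDiag_comm {Z : Matrix a a R} {T : Matrix a b ℂ}
    {Z' : Matrix b b R} (h : Intertwines Z T Z') :
    sandwich (offDiag e T) (blockSum e Z Z') 1 = sandwich 1 (blockSum e Z Z') (offDiag e T) := by
  have h₁ : sandwich (inclLeft e * T) Z' (inclRight e)ᴴ =
      sandwich (inclLeft e) Z (T * (inclRight e)ᴴ) := by
    have := congrArg (fun W => sandwich (inclLeft e) W (inclRight e)ᴴ) h.1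
    simpa only [sandwich_sandwich, Matrix.mul_one, Matrix.one_mul] using this.symm
  have h₂ : sandwich (inclRight e * Tᴴ) Z (inclLeft e)ᴴ =
      sandwich (inclRight e) Z' (Tᴴ * (inclLeft e)ᴴ) := by
    have := congrArg (fun W => sandwich (inclRight e) W (inclLeft e)ᴴ) h.2
    simpa only [sandwich_sandwich, Matrix.mul_one, Matrix.one_mul] using this
  rw [blockSum_eq_sandwich, sandwich_add, sandwich_add, sandwich_sandwich, sandwich_sandwich,
    sandwich_sandwich, sandwich_sandwich, offDiag_mul_inclLeft, offDiag_mul_inclRight,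
    inclLeft_star_mul_offDiag, inclRight_star_mul_offDiag, neg_sandwich, sandwich_neg_right]
  simp only [Matrix.one_mul, Matrix.mul_one]
  rw [h₁, h₂, add_comm]

theorem Intertwines.blockRotation_comm {Z : Matrix a a R} {T : Matrix a b ℂ}
    {Z' : Matrix b b R} (h : Intertwines Z T Z') (θ : ℝ) :
    sandwich (blockRotation e T θ) (blockSum e Z Z') 1 =
      sandwich 1 (blockSum e Z Z') (blockRotation e T θ) := by
  have h₁ := h.offDiag_comm e
  have h₂ : sandwich (offDiag e T * offDiag e T) (blockSum e Z Z') 1 =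
      sandwich 1 (blockSum e Z Z') (offDiag e T * offDiag e T) := by
    have e₁ := congrArg (fun W => sandwich (offDiag e T) W (1 : Matrix c c ℂ)) h₁
    have e₂ := congrArg (fun W => sandwich (1 : Matrix c c ℂ) W (offDiag e T)) h₁
    simp only [sandwich_sandwich, Matrix.mul_one, Matrix.one_mul] at e₁ e₂
    exact e₁.trans e₂
  simp only [blockRotation, add_sandwich, smul_sandwich, sandwich_add_right, sandwich_smul_right,
    h₁, h₂]

theorem Intertwines.sandwich_blockRotation {Z : Matrix a a R} {T : Matrix a b ℂ}
    {Z' : Matrix b b R} (h : Intertwines Z T Z') (hT : T * Tᴴ * T = T) (θ : ℝ) :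
    sandwich (blockRotation e T θ)ᴴ (blockSum e Z Z') (blockRotation e T θ) = blockSum e Z Z' := by
  have hU : (blockRotation e T θ)ᴴ * blockRotation e T θ = 1 :=
    Matrix.mem_unitaryGroup_iff'.1 (blockRotation_mem_unitary e hT θ)
  have key := congrArg (fun W => sandwich (blockRotation e T θ)ᴴ W (1 : Matrix c c ℂ))
    (h.blockRotation_comm e θ)
  simp only [sandwich_sandwich, Matrix.mul_one, hU, one_sandwich_one] at key
  rw [← key]

/-- If `P ⊕ Q` is fixed by a nontrivial rotation then `P T = T Q`. -/
theorem sandwich_eq_of_sandwich_blockRotation {P : Matrix a a R} {T : Matrix a b ℂ}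
    {Q : Matrix b b R} (hT : T * Tᴴ * T = T) {θ : ℝ} (hθ : Real.sin θ ≠ 0)
    (h : sandwich (blockRotation e T θ)ᴴ (blockSum e P Q) (blockRotation e T θ) = blockSum e P Q) :
    sandwich 1 P T = sandwich T Q 1 := by
  have hU : blockRotation e T θ * (blockRotation e T θ)ᴴ = 1 :=
    Matrix.mem_unitaryGroup_iff.1 (blockRotation_mem_unitary e hT θ)
  have key := congrArg (fun W => sandwich ((inclLeft e)ᴴ * blockRotation e T θ) W (inclRight e)) h
  simp only [sandwich_sandwich] at key
  rw [Matrix.mul_assoc, hU, Matrix.mul_one, inclLeft_star_sandwich_blockSum,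
    blockSum_sandwich_inclRight, ← Matrix.mul_assoc, inclLeft_star_blockRotation_inclRight,
    sandwich_smul_right, smul_sandwich] at key
  have hs : (Real.sin θ : ℂ) ≠ 0 := by exact_mod_cast hθ
  have key' := congrArg (fun W => (Real.sin θ : ℂ)⁻¹ • W) key
  simpa only [smul_smul, inv_mul_cancel₀ hs, one_smul] using key'

end Blocks

/-! ### Analyticity along lines, the identity theorem and continuation along paths. -/

section LineAnalytic

variable {E F : Type*} [AddCommGroup E] [Module ℂ E] [TopologicalSpace E]
  [IsTopologicalAddGroup E] [ContinuousSMul ℂ E]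
  [AddCommGroup F] [Module ℂ F] [TopologicalSpace F] [IsTopologicalAddGroup F]
  [ContinuousSMul ℂ F]

/-- `g` is weakly analytic along every complex line, at each point of `U`. -/
def LineAnalyticOn (g : E → F) (U : Set E) : Prop :=
  ∀ x ∈ U, ∀ h : E, ∀ l : F →L[ℂ] ℂ, AnalyticAt ℂ (fun z : ℂ => l (g (x + z • h))) 0

/-- Homogeneity turns the `k`-th term at `z • h` into `z ^ k` times a constant, so a functional
makes the expansion a scalar power series. This weak form of analyticity suffices for the identity
theorem and passes easily through sums and linear maps. -/
theorem IsAnalyticMapOn.lineAnalyticOn {g : E → F} {U : Set E} (hg : IsAnalyticMapOn g U) :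
    LineAnalyticOn g U := by
  intro x hx h l
  obtain ⟨p, hp⟩ := hg.2 x hx
  refine ⟨FormalMultilinearSeries.ofScalars ℂ fun k => l (p k fun _ => h),
    hasFPowerSeriesAt_iff.2 ?_⟩
  have ht : Tendsto (fun z : ℂ => z • h) (𝓝 0) (𝓝 0) := by
    have : Continuous fun z : ℂ => z • h := continuous_id.smul continuous_const
    simpa using this.tendsto 0
  filter_upwards [ht.eventually hp] with z hz
  have h2 := hz.mapL l
  simp only [FormalMultilinearSeries.coeff_ofScalars, zero_add]
  have h3 : ∀ k, z ^ k • l (p k fun _ => h) = l (p k fun _ => z • h) := fun k => by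
    rw [(p k).map_smul_univ]
    simp
  simp only [h3]
  exact h2

theorem LineAnalyticOn.mono {g : E → F} {U V : Set E} (hg : LineAnalyticOn g U) (h : V ⊆ U) :
    LineAnalyticOn g V :=
  fun x hx => hg x (h hx)

theorem LineAnalyticOn.add {g g' : E → F} {U : Set E} (hg : LineAnalyticOn g U)
    (hg' : LineAnalyticOn g' U) : LineAnalyticOn (fun x => g x + g' x) U := by
  intro x hx h l
  simpa only [map_add] using (hg x hx h l).fun_add (hg' x hx h l)

theorem LineAnalyticOn.sub {g g' : E → F} {U : Set E} (hg : LineAnalyticOn g U)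
    (hg' : LineAnalyticOn g' U) : LineAnalyticOn (fun x => g x - g' x) U := by
  intro x hx h l
  simpa only [map_sub] using (hg x hx h l).fun_sub (hg' x hx h l)

section Comp

variable {E' F' : Type*} [AddCommGroup E'] [Module ℂ E'] [TopologicalSpace E']
  [IsTopologicalAddGroup E'] [ContinuousSMul ℂ E']
  [AddCommGroup F'] [Module ℂ F'] [TopologicalSpace F'] [IsTopologicalAddGroup F']
  [ContinuousSMul ℂ F']

theorem LineAnalyticOn.clm_comp {g : E → F} {U : Set E} (hg : LineAnalyticOn g U)
    (L : F →L[ℂ] F') : LineAnalyticOn (fun x => L (g x)) U :=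
  fun x hx h l => hg x hx h (l.comp L)

theorem LineAnalyticOn.comp_clm {g : E → F} {U : Set E} (hg : LineAnalyticOn g U)
    (L : E' →L[ℂ] E) : LineAnalyticOn (fun x => g (L x)) (L ⁻¹' U) := by
  intro x hx h l
  simpa only [map_add, map_smul] using hg (L x) hx (L h) l

/-- Composing an analytic map with a continuous linear map on the left and a continuous affine
map on the right gives an analytic map. -/
theorem IsAnalyticMapOn.clm_comp_affine {g : E → F} {U : Set E} (hg : IsAnalyticMapOn g U)
    (L : F →L[ℂ] F') (A : E' →L[ℂ] E) (c : E) :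
    IsAnalyticMapOn (fun x => L (g (A x + c))) ((fun x => A x + c) ⁻¹' U) := by
  refine ⟨?_, fun x hx => ?_⟩
  · exact L.continuous.comp_continuousOn
      (hg.1.comp (A.continuous.add continuous_const).continuousOn fun x hx => hx)
  · obtain ⟨p, hp⟩ := hg.2 _ hx
    refine ⟨fun k => L.compContinuousMultilinearMap
      ((p k).compContinuousLinearMap fun _ => A), ?_⟩
    have ht : Tendsto A (𝓝 0) (𝓝 0) := by simpa using A.continuous.tendsto 0
    filter_upwards [ht.eventually hp] with h hh
    have h2 := hh.mapL L
    have e : A x + c + A h = A (x + h) + c := by rw [map_add]; abel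
    rw [e] at h2
    exact h2

end Comp

/-- Analyticity on a set is local. -/
theorem IsAnalyticMapOn.of_locally {g : E → F} {U : Set E}
    (h : ∀ x ∈ U, ∃ g' : E → F, ∃ V : Set E, IsOpen V ∧ x ∈ V ∧ IsAnalyticMapOn g' V ∧
      g =ᶠ[𝓝 x] g') : IsAnalyticMapOn g U := by
  refine ⟨fun x hx => ?_, fun x hx => ?_⟩
  · obtain ⟨g', V, hV, hxV, hg', he⟩ := h x hx
    exact (((hg'.1.continuousAt (hV.mem_nhds hxV)).congr he.symm)).continuousWithinAt
  · obtain ⟨g', V, hV, hxV, hg', he⟩ := h x hx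
    obtain ⟨p, hp⟩ := hg'.2 x hxV
    refine ⟨p, ?_⟩
    have ht : Tendsto (fun h : E => x + h) (𝓝 0) (𝓝 x) := by
      have : Continuous fun h : E => x + h := continuous_const.add continuous_id
      simpa using this.tendsto 0
    filter_upwards [hp, ht.eventually he] with k hk hk'
    rwa [hk']

/-- In a topological vector space every neighbourhood contains a smaller open one all of whose
segments stay inside the given one. -/
theorem exists_open_segment_subset {x : E} {U : Set E} (hU : U ∈ 𝓝 x) :
    ∃ W : Set E, IsOpen W ∧ x ∈ W ∧
      ∀ y ∈ W, ∀ z ∈ W, ∀ r : ℝ, 0 ≤ r → r ≤ 1 → y + (r : ℂ) • (z - y) ∈ U := by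
  -- For `y = z = x` the segment is the single point `x`. Compactness of `[0, 1]` then gives a
  -- neighbourhood uniform in `r`, without local convexity.
  have h1 : ∀ r ∈ Set.Icc (0 : ℝ) 1, ∀ᶠ p : (E × E) × ℝ in 𝓝 (x, x) ×ˢ 𝓝 r,
      p.1.1 + (p.2 : ℂ) • (p.1.2 - p.1.1) ∈ U := by
    intro r _
    have hc : Continuous fun p : (E × E) × ℝ => p.1.1 + (p.2 : ℂ) • (p.1.2 - p.1.1) :=
      (continuous_fst.comp continuous_fst).add
        ((Complex.continuous_ofReal.comp continuous_snd).smul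
          ((continuous_snd.comp continuous_fst).sub (continuous_fst.comp continuous_fst)))
    rw [← nhds_prod_eq]
    refine hc.continuousAt.eventually_mem ?_
    simpa using hU
  have h2 := isCompact_Icc.eventually_forall_of_forall_eventually (x₀ := ((x, x) : E × E))
    (K := Set.Icc (0 : ℝ) 1) (P := fun p r => p.1 + (r : ℂ) • (p.2 - p.1) ∈ U)
    (fun r hr => by rw [nhds_prod_eq]; exact h1 r hr)
  rw [nhds_prod_eq] at h2
  obtain ⟨V, hV, hVU⟩ := eventually_prod_self_iff (r := fun y z => ∀ r ∈ Set.Icc (0 : ℝ) 1,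
    y + (r : ℂ) • (z - y) ∈ U) |>.1 h2
  obtain ⟨W, hWV, hW, hxW⟩ := mem_nhds_iff.1 (hV)
  exact ⟨W, hW, hxW, fun y hy z hz r h0 h1 => hVU y (hWV hy) z (hWV hz) r ⟨h0, h1⟩⟩

variable [SeparatingDual ℂ F]

/-- Local identity theorem, uniformly in the functions. -/
theorem exists_open_eqOn_of_lineAnalyticOn {x : E} {U : Set E} (hU : U ∈ 𝓝 x) :
    ∃ W : Set E, IsOpen W ∧ x ∈ W ∧ ∀ g g' : E → F, LineAnalyticOn g U → LineAnalyticOn g' U →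
      ∀ y ∈ W, g =ᶠ[𝓝 y] g' → Set.EqOn g g' W := by
  obtain ⟨W, hW, hxW, hseg⟩ := exists_open_segment_subset hU
  refine ⟨W, hW, hxW, fun g g' hg hg' y hy he z hz => ?_⟩
  by_contra hne
  obtain ⟨l, hl⟩ := SeparatingDual.exists_ne_zero (R := ℂ) (sub_ne_zero.2 hne)
  apply hl
  -- The real segment, seen in the complex line through `y` and `z`, is the connected set for the
  -- one-variable identity theorem.
  set S : Set ℂ := (fun r : ℝ => (r : ℂ)) '' Set.Icc 0 1
  have hS : IsPreconnected S :=
    isPreconnected_Icc.image _ Complex.continuous_ofReal.continuousOn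
  have ha : AnalyticOnNhd ℂ (fun w : ℂ => l (g (y + w • (z - y)) - g' (y + w • (z - y)))) S := by
    rintro _ ⟨r, hr, rfl⟩
    have h0 := (hg.sub hg') _ (hseg y hy z hz r hr.1 hr.2) (z - y) l
    have h1 : AnalyticAt ℂ (fun w : ℂ => w - (r : ℂ)) (r : ℂ) := by fun_prop
    have h2 := AnalyticAt.fun_comp (g := fun w : ℂ => l (g (y + (r : ℂ) • (z - y) + w • (z - y)) -
      g' (y + (r : ℂ) • (z - y) + w • (z - y)))) (f := fun w : ℂ => w - (r : ℂ)) (x := (r : ℂ))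
      (by simpa using h0) h1
    refine h2.congr (Eventually.of_forall fun w => ?_)
    have : y + (r : ℂ) • (z - y) + (w - (r : ℂ)) • (z - y) = y + w • (z - y) := by
      rw [add_assoc, ← add_smul, add_sub_cancel]
    simp only [this]
  have hev : (fun w : ℂ => l (g (y + w • (z - y)) - g' (y + w • (z - y)))) =ᶠ[𝓝 0] 0 := by
    have ht : Tendsto (fun w : ℂ => y + w • (z - y)) (𝓝 0) (𝓝 y) := by
      have : Continuous fun w : ℂ => y + w • (z - y) :=
        continuous_const.add (continuous_id.smul continuous_const)
      simpa using this.tendsto 0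
    filter_upwards [ht.eventually he] with w hw
    simp [hw]
  have h3 := ha.eqOn_zero_of_preconnected_of_eventuallyEq_zero hS
    (⟨0, by simp, by simp⟩ : (0 : ℂ) ∈ S) hev
  have h4 := h3 (⟨1, by simp, by simp⟩ : (1 : ℂ) ∈ S)
  simpa using h4

/-- Permanence of functional equations: two families of analytic germs along a path, depending on
a parameter, agree along the whole path (for the parameters in a neighbourhood that may depend on
the point of the path) if they agree at its start. -/
theorem eventuallyEq_along_path {Λ : Type*} {ℓ : Filter Λ} (γ : C(unitInterval, E))
    (H K : Λ → unitInterval → E → F)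
    (han : ∀ t, ∃ U ∈ 𝓝 (γ t), ∀ᶠ a in ℓ, LineAnalyticOn (H a t) U ∧ LineAnalyticOn (K a t) U)
    (hH : ∀ t, ∀ᶠ s in 𝓝 t, ∀ᶠ a in ℓ, H a s =ᶠ[𝓝 (γ s)] H a t)
    (hK : ∀ t, ∀ᶠ s in 𝓝 t, ∀ᶠ a in ℓ, K a s =ᶠ[𝓝 (γ s)] K a t)
    (h0 : ∀ᶠ a in ℓ, H a 0 =ᶠ[𝓝 (γ 0)] K a 0) (t : unitInterval) :
    ∀ᶠ a in ℓ, H a t =ᶠ[𝓝 (γ t)] K a t := by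
  -- The truth value of the agreement is locally constant in `t`, hence constant on the connected
  -- interval. The set `W` below depends on `U` alone, so it serves almost all parameters at once.
  have hloc : IsLocallyConstant fun t => ∀ᶠ a in ℓ, H a t =ᶠ[𝓝 (γ t)] K a t := by
    rw [IsLocallyConstant.iff_eventually_eq]
    intro t
    obtain ⟨U, hU, hUa⟩ := han t
    obtain ⟨W, hW, htW, hid⟩ := exists_open_eqOn_of_lineAnalyticOn (F := F) hU
    have hsW : ∀ᶠ s in 𝓝 t, γ s ∈ W := γ.continuous.continuousAt.eventually_mem (hW.mem_nhds htW)
    filter_upwards [hH t, hK t, hsW] with s h1 h2 hs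
    refine propext ⟨fun h => ?_, fun h => ?_⟩
    · filter_upwards [h, h1, h2, hUa] with a ha ha1 ha2 hU
      exact (hid _ _ hU.1 hU.2 (γ s) hs ((ha1.symm.trans ha).trans ha2)).eventuallyEq_of_mem
        (hW.mem_nhds htW)
    · filter_upwards [h, h1, h2, hUa] with a ha ha1 ha2 hU
      exact (ha1.trans ((hid _ _ hU.1 hU.2 (γ t) htW ha).eventuallyEq_of_mem
        (hW.mem_nhds hs))).trans ha2.symm
  have := hloc.apply_eq_of_preconnectedSpace t 0
  rw [this]
  exact h0

/-- Uniqueness of the continuation along a path. -/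
theorem IsContinuationAlong.eventuallyEq {f : E → F} {γ : C(unitInterval, E)}
    {G G' : unitInterval → E → F} (h : IsContinuationAlong f γ G)
    (h' : IsContinuationAlong f γ G') (t : unitInterval) : G t =ᶠ[𝓝 (γ t)] G' t := by
  have := eventuallyEq_along_path (ℓ := pure ()) γ (fun _ => G) (fun _ => G')
    (fun t => by
      obtain ⟨U, hU, htU, hUa⟩ := h.analytic t
      obtain ⟨V, hV, htV, hVa⟩ := h'.analytic t
      exact ⟨U ∩ V, (hU.inter hV).mem_nhds ⟨htU, htV⟩, Eventually.of_forall fun _ =>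
        ⟨hUa.lineAnalyticOn.mono Set.inter_subset_left,
          hVa.lineAnalyticOn.mono Set.inter_subset_right⟩⟩)
    (fun t => (h.compatible t).mono fun s hs => Eventually.of_forall fun _ => hs)
    (fun t => (h'.compatible t).mono fun s hs => Eventually.of_forall fun _ => hs)
    (Eventually.of_forall fun _ => h.start.trans h'.start.symm) t
  simpa using this

omit [SeparatingDual ℂ F] in
/-- A function analytic on an open set continues itself. -/
theorem IsAnalyticMapOn.isContinuationAlong {f g : E → F} {U V : Set E} (hU : IsOpen U)
    (hg : IsAnalyticMapOn g U) (hV : IsOpen V) (he : Set.EqOn g f V) (γ : C(unitInterval, E))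
    (h0 : γ 0 ∈ V) (hγ : ∀ t, γ t ∈ U) : IsContinuationAlong f γ fun _ => g where
  analytic t := ⟨U, hU, hγ t, hg⟩
  start := he.eventuallyEq_of_mem (hV.mem_nhds h0)
  compatible _ := Eventually.of_forall fun _ => EventuallyEq.rfl

omit [SeparatingDual ℂ F] in
/-- A continuation along `γ` extends to the points near the end of `γ`. -/
theorem IsContinuationAlong.exists_extension {f : E → F} {γ : C(unitInterval, E)}
    {G : unitInterval → E → F} (h : IsContinuationAlong f γ G) {D : Set E} (hD : IsOpen D)
    (hγ : ∀ t, γ t ∈ D) :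
    ∀ᶠ Z in 𝓝 (γ 1), ∃ (γ' : C(unitInterval, E)) (G' : unitInterval → E → F),
      γ' 0 = γ 0 ∧ (∀ t, γ' t ∈ D) ∧ IsContinuationAlong f γ' G' ∧ γ' 1 = Z ∧ G' 1 = G 1 := by
  obtain ⟨U, hU, h1U, hUa⟩ := h.analytic 1
  obtain ⟨W, hW, h1W, hseg⟩ :=
    exists_open_segment_subset ((hU.inter hD).mem_nhds ⟨h1U, hγ 1⟩)
  filter_upwards [hW.mem_nhds h1W] with Z hZ
  -- The new path runs through `γ` at double speed by `τ`, then along the segment from `γ 1` to `Z`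
  -- by `σ`, during which the germ stays that of `G 1`.
  let τ : unitInterval → unitInterval := fun t => Set.projIcc 0 1 zero_le_one (2 * (t : ℝ))
  have hτ : Continuous τ :=
    continuous_projIcc.comp (continuous_const.mul continuous_subtype_val)
  let σ : unitInterval → ℝ := fun t => max (2 * (t : ℝ) - 1) 0
  have hσ : Continuous σ :=
    ((continuous_const.mul continuous_subtype_val).sub continuous_const).max continuous_const
  have hσ0 : ∀ t : unitInterval, (t : ℝ) ≤ 1 / 2 → σ t = 0 := fun t ht =>
    max_eq_right (by linarith)
  have hτ1 : ∀ t : unitInterval, 1 / 2 ≤ (t : ℝ) → τ t = 1 := fun t ht =>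
    Set.projIcc_of_right_le _ (by linarith)
  let γ' : C(unitInterval, E) :=
    ⟨fun t => γ (τ t) + (σ t : ℂ) • (Z - γ 1), (γ.continuous.comp hτ).add
      ((Complex.continuous_ofReal.comp hσ).smul continuous_const)⟩
  have hγ'1 : ∀ t : unitInterval, (t : ℝ) ≤ 1 / 2 → γ' t = γ (τ t) := fun t ht => by
    simp [γ', hσ0 t ht]
  have hγ'2 : ∀ t : unitInterval, 1 / 2 ≤ (t : ℝ) → γ' t ∈ U ∩ D := fun t ht => by
    have := hseg (γ 1) h1W Z hZ (σ t) (le_max_right _ _)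
      (max_le (by linarith [t.2.2]) zero_le_one)
    simpa [γ', hτ1 t ht] using this
  refine ⟨γ', fun t => G (τ t), ?_, fun t => ?_, ⟨fun t => ?_, ?_, fun t => ?_⟩, ?_, ?_⟩
  · rw [hγ'1 0 (by norm_num)]
    congr 1
    simp [τ]
  · rcases le_total (t : ℝ) (1 / 2) with ht | ht
    · rw [hγ'1 t ht]; exact hγ _
    · exact (hγ'2 t ht).2
  · rcases le_total (t : ℝ) (1 / 2) with ht | ht
    · rw [hγ'1 t ht]; exact h.analytic _
    · rw [hτ1 t ht]; exact ⟨U, hU, (hγ'2 t ht).1, hUa⟩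
  · have h0 : τ 0 = 0 := by simp [τ]
    rw [hγ'1 0 (by norm_num), h0]
    exact h.start
  · rcases lt_or_ge (t : ℝ) (1 / 2) with ht | ht
    · filter_upwards [hτ.continuousAt.eventually (h.compatible (τ t)),
        continuous_subtype_val.continuousAt.eventually_lt continuousAt_const ht] with s hs hs'
      rw [hγ'1 s hs'.le]
      exact hs
    · filter_upwards [hτ.continuousAt.eventually (h.compatible (τ t))] with s hs
      rcases le_total (s : ℝ) (1 / 2) with hs' | hs'
      · rw [hγ'1 s hs']
        exact hs
      · rw [hτ1 s hs', hτ1 t ht]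
  · have : σ 1 = 1 := by simp [σ]; norm_num
    simp [γ', hτ1 1 (by norm_num), this]
  · simp [hτ1 1 (by norm_num)]

end LineAnalytic

/-! ### Calculus of intertwining relations. -/

section Intertwines

open Matrix

variable {R : Type*} [AddCommGroup R] [Module ℂ R]
variable {a b c : Type*} [Fintype a] [Fintype b] [Fintype c] [DecidableEq a] [DecidableEq b]
  [DecidableEq c]

theorem Intertwines.symm {Z : Matrix a a R} {T : Matrix a b ℂ} {W : Matrix b b R}
    (h : Intertwines Z T W) : Intertwines W Tᴴ Z :=
  ⟨h.2.symm, by rw [conjTranspose_conjTranspose]; exact h.1.symm⟩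

theorem sandwich_one_mul_eq {Z : Matrix a a R} {S : Matrix a b ℂ} {W : Matrix b b R}
    {T : Matrix b c ℂ} {V : Matrix c c R} (h : sandwich 1 Z S = sandwich S W 1)
    (h' : sandwich 1 W T = sandwich T V 1) : sandwich 1 Z (S * T) = sandwich (S * T) V 1 := by
  have h₁ := congrArg (fun M => sandwich (1 : Matrix a a ℂ) M T) h
  have h₂ := congrArg (fun M => sandwich S M (1 : Matrix c c ℂ)) h'
  simp only [sandwich_sandwich, Matrix.mul_one, Matrix.one_mul] at h₁ h₂
  exact h₁.trans h₂

theorem Intertwines.trans {Z : Matrix a a R} {S : Matrix a b ℂ} {W : Matrix b b R}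
    {T : Matrix b c ℂ} {V : Matrix c c R} (h : Intertwines Z S W) (h' : Intertwines W T V) :
    Intertwines Z (S * T) V := by
  refine ⟨sandwich_one_mul_eq h.1 h'.1, ?_⟩
  rw [conjTranspose_mul]
  exact (sandwich_one_mul_eq h'.2.symm h.2.symm).symm

theorem Intertwines.refl (Z : Matrix a a R) : Intertwines Z 1 Z :=
  ⟨rfl, by rw [conjTranspose_one]⟩

theorem intertwines_blockSum_inclLeft (e : a ⊕ b ≃ c) (X : Matrix a a R) (Y : Matrix b b R) :
    Intertwines (blockSum e X Y) (inclLeft e) X := by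
  constructor
  · rw [blockSum_sandwich_inclLeft, Matrix.one_mul]
  · rw [inclLeft_star_sandwich_blockSum, Matrix.mul_one]

theorem intertwines_blockSum_inclRight (e : a ⊕ b ≃ c) (X : Matrix a a R) (Y : Matrix b b R) :
    Intertwines (blockSum e X Y) (inclRight e) Y := by
  constructor
  · rw [blockSum_sandwich_inclRight, Matrix.one_mul]
  · rw [inclRight_star_sandwich_blockSum, Matrix.mul_one]

theorem inclLeft_mul_star_add_inclRight_mul_star (e : a ⊕ b ≃ c) :
    inclLeft e * (inclLeft e)ᴴ + inclRight e * (inclRight e)ᴴ = 1 := by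
  ext i j
  obtain ⟨i, rfl⟩ := e.surjective i
  obtain ⟨j, rfl⟩ := e.surjective j
  rcases i with i | i <;> rcases j with j | j <;>
    simp [inclLeft, inclRight, Matrix.mul_apply, Matrix.one_apply, eq_comm]

/-- The range projections of the two inclusions add up to `1`, so `W` is determined by its products
with them. This turns intertwining by the inclusions into compatibility with direct sums. -/
theorem eq_blockSum_of_sandwich (e : a ⊕ b ≃ c) {W : Matrix c c R} {P : Matrix a a R}
    {Q : Matrix b b R} (h₁ : sandwich 1 W (inclLeft e) = sandwich (inclLeft e) P 1)
    (h₂ : sandwich 1 W (inclRight e) = sandwich (inclRight e) Q 1) : W = blockSum e P Q := by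
  have e₁ := congrArg (fun M => sandwich (1 : Matrix c c ℂ) M (inclLeft e)ᴴ) h₁
  have e₂ := congrArg (fun M => sandwich (1 : Matrix c c ℂ) M (inclRight e)ᴴ) h₂
  simp only [sandwich_sandwich, Matrix.mul_one, Matrix.one_mul] at e₁ e₂
  rw [blockSum_eq_sandwich, ← e₁, ← e₂, ← sandwich_add_right,
    inclLeft_mul_star_add_inclRight_mul_star, one_sandwich_one]

theorem mul_conjTranspose_mul_of_isometry {J : Matrix a b ℂ} (hJ : Jᴴ * J = 1) :
    J * Jᴴ * J = J := by
  rw [Matrix.mul_assoc, hJ, Matrix.mul_one]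

theorem intertwines_of_unitary (X : Matrix a a R) {V : Matrix a a ℂ} (hV : V * Vᴴ = 1) :
    Intertwines X V (sandwich Vᴴ X V) := by
  constructor
  · rw [sandwich_sandwich, hV, Matrix.mul_one]
  · rw [sandwich_sandwich, hV, Matrix.one_mul]

end Intertwines

/-! ### Functional equations of free functions under continuation. -/

section Continuations

open Matrix

/-- The `(i, j)` entry as a continuous linear map. -/
def entryCLM {R : Type*} [AddCommGroup R] [Module ℂ R] [TopologicalSpace R] {a b : Type*}
    (i : a) (j : b) : Matrix a b R →L[ℂ] R where
  toFun Y := Y i j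
  map_add' _ _ := rfl
  map_smul' _ _ := rfl
  cont := continuous_id.matrix_elem i j

instance instSeparatingDualMatrix {R : Type*} [AddCommGroup R] [Module ℂ R] [TopologicalSpace R]
    [SeparatingDual ℂ R] {a b : Type*} : SeparatingDual ℂ (Matrix a b R) where
  exists_ne_zero' X hX := by
    obtain ⟨i, j, hij⟩ : ∃ i j, X i j ≠ 0 := by
      by_contra! h
      exact hX (Matrix.ext h)
    obtain ⟨l, hl⟩ := SeparatingDual.exists_ne_zero (R := ℂ) hij
    exact ⟨l.comp (entryCLM i j), hl⟩

variable {R₁ R₂ : Type*}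
  [AddCommGroup R₁] [Module ℂ R₁] [TopologicalSpace R₁] [IsTopologicalAddGroup R₁]
  [ContinuousSMul ℂ R₁]
  [AddCommGroup R₂] [Module ℂ R₂] [TopologicalSpace R₂] [IsTopologicalAddGroup R₂]
  [ContinuousSMul ℂ R₂]

/-- The identification of indices underlying the direct sum. -/
def sumEquiv (n m : ℕ+) : Fin n ⊕ Fin m ≃ Fin (n + m : ℕ+) := finSumFinEquiv

/-- The direct sum as a continuous linear map. -/
noncomputable def dirSumCLM (n m : ℕ+) :
    MatLevel R₁ n × MatLevel R₁ m →L[ℂ] MatLevel R₁ (n + m) :=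
  (sandwichCLM (inclLeft (sumEquiv n m)) (inclLeft (sumEquiv n m))ᴴ).comp
      (ContinuousLinearMap.fst ℂ _ _) +
    (sandwichCLM (inclRight (sumEquiv n m)) (inclRight (sumEquiv n m))ᴴ).comp
      (ContinuousLinearMap.snd ℂ _ _)

theorem dirSum_eq_sandwich {n m : ℕ+} (X : MatLevel R₁ n) (Y : MatLevel R₁ m) :
    dirSum X Y = sandwich (inclLeft (sumEquiv n m)) X (inclLeft (sumEquiv n m))ᴴ +
      sandwich (inclRight (sumEquiv n m)) Y (inclRight (sumEquiv n m))ᴴ :=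
  blockSum_eq_sandwich (sumEquiv n m) X Y

theorem dirSumCLM_apply {n m : ℕ+} (q : MatLevel R₁ n × MatLevel R₁ m) :
    dirSumCLM n m q = dirSum q.1 q.2 :=
  (dirSum_eq_sandwich q.1 q.2).symm

theorem starConj_one {n : ℕ+} (X : MatLevel R₁ n) : starConj 1 X = X := by
  have h : starConj 1 X = sandwich (1 : MatLevel ℂ n)ᴴ X 1 := rfl
  rw [h, conjTranspose_one, one_sandwich_one]

theorem tendsto_starConj {n : ℕ+} (X : MatLevel R₁ n) :
    Tendsto (fun q : MatLevel ℂ n × MatLevel R₁ n => starConj q.1 q.2) (𝓝 1 ×ˢ 𝓝 X) (𝓝 X) := by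
  have hc : Continuous fun q : MatLevel ℂ n × MatLevel R₁ n => starConj q.1 q.2 := by
    refine continuous_matrix fun i j => ?_
    change Continuous fun q : MatLevel ℂ n × MatLevel R₁ n =>
      ∑ k, ∑ l, (star (q.1 k i) * q.1 l j) • q.2 k l
    refine continuous_finsetSum _ fun k _ => continuous_finsetSum _ fun l _ => ?_
    have h₁ : ∀ k l, Continuous fun q : MatLevel ℂ n × MatLevel R₁ n => q.1 k l := fun k l =>
      continuous_fst.matrix_elem k l
    have h₂ : ∀ k l, Continuous fun q : MatLevel ℂ n × MatLevel R₁ n => q.2 k l := fun k l =>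
      continuous_snd.matrix_elem k l
    exact ((h₁ k i).star.mul (h₁ l j)).smul (h₂ k l)
  have := hc.tendsto (1, X)
  rwa [nhds_prod_eq, starConj_one] at this

variable [SeparatingDual ℂ R₂]

/-- Equivariance under unitaries near `1` is preserved by continuation. -/
theorem IsContinuationAlong.starConj_eventuallyEq
    {B : ∀ n : ℕ+, Set (MatLevel R₁ n)} (hBopen : IsOpenFree B)
    {f : ∀ n : ℕ+, MatLevel R₁ n → MatLevel R₂ n} (hf : IsFreeAnalyticOn f B)
    {n : ℕ+} {γ : C(unitInterval, MatLevel R₁ n)} {G : unitInterval → MatLevel R₁ n → MatLevel R₂ n}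
    (hG : IsContinuationAlong (f n) γ G) (h0 : γ 0 ∈ B n) (t : unitInterval) :
    ∀ᶠ V in 𝓝[(unitaryGroup (Fin n) ℂ : Set (MatLevel ℂ n))] 1,
      (fun Z => G t (starConj V Z)) =ᶠ[𝓝 (γ t)] fun Z => starConj V (G t Z) := by
  -- The parameter is the unitary `V` tending to `1`: a germ at `γ t` can only be compared at
  -- `starConj V Z` while that point stays where `G t` is analytic.
  refine eventuallyEq_along_path γ (fun V t Z => G t (starConj V Z))
    (fun V t Z => starConj V (G t Z)) (fun t => ?_) (fun t => ?_) (fun t => ?_) ?_ t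
  · obtain ⟨U, hU, htU, hUa⟩ := hG.analytic t
    obtain ⟨S, hS, U', hU', hsub⟩ :=
      mem_prod_iff.1 ((tendsto_starConj (γ t)).eventually_mem (hU.mem_nhds htU))
    refine ⟨U ∩ U', inter_mem (hU.mem_nhds htU) hU', mem_nhdsWithin_of_mem_nhds ?_⟩
    filter_upwards [hS] with V hV
    have hU₁ : LineAnalyticOn (fun Z => G t (starConj V Z)) (starConj V ⁻¹' U) :=
      hUa.lineAnalyticOn.comp_clm (sandwichCLM Vᴴ V)
    have hU₂ : LineAnalyticOn (fun Z => starConj V (G t Z)) U :=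
      hUa.lineAnalyticOn.clm_comp (sandwichCLM Vᴴ V)
    have hmem : ∀ Z ∈ U', starConj V Z ∈ U := fun Z hZ => by
      have h : (V, Z) ∈ {q : MatLevel ℂ n × MatLevel R₁ n | starConj q.1 q.2 ∈ U} :=
        hsub (Set.mk_mem_prod hV hZ)
      exact h
    exact ⟨hU₁.mono fun Z hZ => hmem Z hZ.2, hU₂.mono Set.inter_subset_left⟩
  · filter_upwards [hG.compatible t] with s hs
    exact mem_nhdsWithin_of_mem_nhds ((tendsto_starConj (γ s)).eventually hs).curry
  · filter_upwards [hG.compatible t] with s hs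
    exact Eventually.of_forall fun V => hs.mono fun Z hZ => congrArg (starConj V) hZ
  · have h1 := (((tendsto_starConj (γ 0)).eventually hG.start)).curry
    filter_upwards [self_mem_nhdsWithin, mem_nhdsWithin_of_mem_nhds h1] with V hV h1
    filter_upwards [h1, hG.start, (hBopen n).mem_nhds h0] with Z hZ hZ' hZB
    rw [hZ, hZ', hf.map_starConj hZB hV]

/-- The continuation along a direct sum of paths is, on direct sums, the direct sum of the
continuations. -/
theorem IsContinuationAlong.dirSum_eventuallyEq
    {B : ∀ n : ℕ+, Set (MatLevel R₁ n)} (hBopen : IsOpenFree B)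
    {f : ∀ n : ℕ+, MatLevel R₁ n → MatLevel R₂ n} (hf : IsFreeAnalyticOn f B)
    {n m : ℕ+} {γ₁ : C(unitInterval, MatLevel R₁ n)} {γ₂ : C(unitInterval, MatLevel R₁ m)}
    {γ : C(unitInterval, MatLevel R₁ (n + m))} (hγ : ∀ t, γ t = dirSum (γ₁ t) (γ₂ t))
    {G₁ : unitInterval → MatLevel R₁ n → MatLevel R₂ n}
    {G₂ : unitInterval → MatLevel R₁ m → MatLevel R₂ m}
    {G : unitInterval → MatLevel R₁ (n + m) → MatLevel R₂ (n + m)}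
    (hG₁ : IsContinuationAlong (f n) γ₁ G₁) (hG₂ : IsContinuationAlong (f m) γ₂ G₂)
    (hG : IsContinuationAlong (f (n + m)) γ G) (h₁ : γ₁ 0 ∈ B n) (h₂ : γ₂ 0 ∈ B m)
    (t : unitInterval) :
    (fun q : MatLevel R₁ n × MatLevel R₁ m => G t (dirSum q.1 q.2)) =ᶠ[𝓝 (γ₁ t, γ₂ t)]
      fun q => dirSum (G₁ t q.1) (G₂ t q.2) := by
  have hd : ∀ t, Tendsto (fun q : MatLevel R₁ n × MatLevel R₁ m => dirSum q.1 q.2)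
      (𝓝 (γ₁ t, γ₂ t)) (𝓝 (γ t)) := fun t => by
    have := (dirSumCLM (R₁ := R₁) n m).continuous.tendsto (γ₁ t, γ₂ t)
    rw [dirSumCLM_apply, ← hγ] at this
    exact this.congr fun q => dirSumCLM_apply q
  have hfst : ∀ t, Tendsto (Prod.fst : MatLevel R₁ n × MatLevel R₁ m → _)
      (𝓝 (γ₁ t, γ₂ t)) (𝓝 (γ₁ t)) := fun t => continuous_fst.tendsto _
  have hsnd : ∀ t, Tendsto (Prod.snd : MatLevel R₁ n × MatLevel R₁ m → _)
      (𝓝 (γ₁ t, γ₂ t)) (𝓝 (γ₂ t)) := fun t => continuous_snd.tendsto _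
  have key := eventuallyEq_along_path (ℓ := pure ()) (γ₁.prodMk γ₂)
    (fun _ t q => G t (dirSum q.1 q.2)) (fun _ t q => dirSum (G₁ t q.1) (G₂ t q.2))
    (fun t => ?_) (fun t => ?_) (fun t => ?_) (Eventually.of_forall fun _ => ?_) t
  · simpa using key
  · obtain ⟨U, hU, htU, hUa⟩ := hG.analytic t
    obtain ⟨U₁, hU₁, htU₁, hUa₁⟩ := hG₁.analytic t
    obtain ⟨U₂, hU₂, htU₂, hUa₂⟩ := hG₂.analytic t
    refine ⟨_, inter_mem ((hd t).eventually_mem (hU.mem_nhds htU)) (inter_mem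
      ((hfst t).eventually_mem (hU₁.mem_nhds htU₁)) ((hsnd t).eventually_mem (hU₂.mem_nhds htU₂))),
      Eventually.of_forall fun _ => ⟨?_, ?_⟩⟩
    · have := hUa.lineAnalyticOn.comp_clm (dirSumCLM n m)
      simp only [dirSumCLM_apply] at this
      refine this.mono fun q hq => ?_
      have hq1 := hq.1
      rw [Set.mem_preimage, dirSumCLM_apply]
      exact hq1
    · have e₁ := (hUa₁.lineAnalyticOn.comp_clm (ContinuousLinearMap.fst ℂ _ (MatLevel R₁ m))).clm_comp
        (sandwichCLM (inclLeft (sumEquiv n m)) (inclLeft (sumEquiv n m))ᴴ)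
      have e₂ := (hUa₂.lineAnalyticOn.comp_clm (ContinuousLinearMap.snd ℂ (MatLevel R₁ n) _)).clm_comp
        (sandwichCLM (inclRight (sumEquiv n m)) (inclRight (sumEquiv n m))ᴴ)
      have e₃ := (e₁.mono (V := _ ∩ _) Set.inter_subset_left).add (e₂.mono Set.inter_subset_right)
      simp only [dirSum_eq_sandwich]
      exact e₃.mono fun q hq => hq.2
  · filter_upwards [hG.compatible t] with s hs
    exact Eventually.of_forall fun _ => (hd s).eventually hs
  · filter_upwards [hG₁.compatible t, hG₂.compatible t] with s hs₁ hs₂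
    refine Eventually.of_forall fun _ => ?_
    filter_upwards [(hfst s).eventually hs₁, (hsnd s).eventually hs₂] with q hq₁ hq₂
    rw [hq₁, hq₂]
  · filter_upwards [(hd 0).eventually hG.start, (hfst 0).eventually hG₁.start,
      (hsnd 0).eventually hG₂.start, (hfst 0).eventually_mem ((hBopen n).mem_nhds h₁),
      (hsnd 0).eventually_mem ((hBopen m).mem_nhds h₂)] with q hq hq₁ hq₂ hB₁ hB₂
    rw [hq, hq₁, hq₂, hf.map_dirSum hB₁ hB₂]

/-! ### Continued values and the rotation argument. -/

/-- `P` is the value at `Z` of a continuation of `f` along a path from `B` to `Z` in `D`. -/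
def IsContinuedValue (D B : ∀ n : ℕ+, Set (MatLevel R₁ n))
    (f : ∀ n : ℕ+, MatLevel R₁ n → MatLevel R₂ n) (n : ℕ+) (Z : MatLevel R₁ n)
    (P : MatLevel R₂ n) : Prop :=
  ∃ (γ : C(unitInterval, MatLevel R₁ n)) (G : unitInterval → MatLevel R₁ n → MatLevel R₂ n),
    γ 0 ∈ B n ∧ (∀ t, γ t ∈ D n) ∧ IsContinuationAlong (f n) γ G ∧ γ 1 = Z ∧ G 1 Z = P

/-- `f` continues analytically along all paths in `D` starting in `B`. -/
def ContinuesAlongPaths (D B : ∀ n : ℕ+, Set (MatLevel R₁ n))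
    (f : ∀ n : ℕ+, MatLevel R₁ n → MatLevel R₂ n) : Prop :=
  ∀ (n : ℕ+) (γ : C(unitInterval, MatLevel R₁ n)), γ 0 ∈ B n → (∀ t, γ t ∈ D n) →
    ∃ G, IsContinuationAlong (f n) γ G

/-- Continued values respect intertwining by partial isometries. -/
theorem IsContinuedValue.intertwines {D B : ∀ n : ℕ+, Set (MatLevel R₁ n)} (hD : IsFreeSet D)
    (hB : IsFreeSet B) (hBopen : IsOpenFree B)
    {f : ∀ n : ℕ+, MatLevel R₁ n → MatLevel R₂ n} (hf : IsFreeAnalyticOn f B)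
    (hc : ContinuesAlongPaths D B f) {n m : ℕ+} {Z : MatLevel R₁ n} {Z' : MatLevel R₁ m}
    {P : MatLevel R₂ n} {P' : MatLevel R₂ m} (h : IsContinuedValue D B f n Z P)
    (h' : IsContinuedValue D B f m Z' P') {T : Matrix (Fin n) (Fin m) ℂ}
    (hT : T * Tᴴ * T = T) (hZ : Intertwines Z T Z') : sandwich 1 P T = sandwich T P' 1 := by
  obtain ⟨γ₁, G₁, hB₁, hD₁, hG₁, rfl, rfl⟩ := h
  obtain ⟨γ₂, G₂, hB₂, hD₂, hG₂, rfl, rfl⟩ := h'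
  let γ : C(unitInterval, MatLevel R₁ (n + m)) :=
    ⟨fun t => dirSumCLM n m (γ₁ t, γ₂ t),
      (dirSumCLM n m).continuous.comp (γ₁.continuous.prodMk γ₂.continuous)⟩
  have hγ : ∀ t, γ t = dirSum (γ₁ t) (γ₂ t) := fun t => dirSumCLM_apply _
  have hγ0 : γ 0 ∈ B (n + m) := by rw [hγ]; exact hB.dirSum_mem hB₁ hB₂
  obtain ⟨G, hG⟩ := hc (n + m) γ hγ0 fun t => by rw [hγ]; exact hD.dirSum_mem (hD₁ t) (hD₂ t)
  have hsum : G 1 (γ 1) = dirSum (G₁ 1 (γ₁ 1)) (G₂ 1 (γ₂ 1)) := by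
    rw [hγ]
    exact (hG₁.dirSum_eventuallyEq hBopen hf hγ hG₂ hG hB₁ hB₂ 1).self_of_nhds
  let e : Fin n ⊕ Fin m ≃ Fin (n + m : ℕ+) := (sumEquiv n m)
  -- Small positive angles keep the rotation within the range of local equivariance and still have
  -- `sin θ ≠ 0`, which the corner comparison divides by.
  have hrot : Tendsto (blockRotation e T) (𝓝[>] 0)
      (𝓝[(unitaryGroup (Fin (n + m : ℕ+)) ℂ : Set (MatLevel ℂ (n + m)))] 1) := by
    refine tendsto_nhdsWithin_iff.2 ⟨?_, Eventually.of_forall fun θ =>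
      blockRotation_mem_unitary e hT θ⟩
    have := (continuous_blockRotation e T).tendsto 0
    rw [blockRotation_zero] at this
    exact this.mono_left nhdsWithin_le_nhds
  have hsin : ∀ᶠ θ : ℝ in 𝓝[>] 0, Real.sin θ ≠ 0 := by
    filter_upwards [Ioo_mem_nhdsGT Real.pi_pos] with θ hθ
    exact (Real.sin_pos_of_pos_of_lt_pi hθ.1 hθ.2).ne'
  obtain ⟨θ, hθ, hs⟩ :=
    ((hrot.eventually (hG.starConj_eventuallyEq hBopen hf hγ0 1)).and hsin).exists
  have hθ1 : G 1 (starConj (blockRotation e T θ) (γ 1)) =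
      starConj (blockRotation e T θ) (G 1 (γ 1)) := hθ.self_of_nhds
  have hfix : starConj (blockRotation e T θ) (γ 1) = γ 1 := by
    rw [hγ]
    exact hZ.sandwich_blockRotation e hT θ
  rw [hfix, hsum] at hθ1
  exact sandwich_eq_of_sandwich_blockRotation e hT hs hθ1.symm

/-! ### Compressed values, which reach the levels where `B` is empty. -/

/-- `P` is the compression of a continued value to an isometrically embedded direct summand
`X`. -/
def IsCompressedValue (D B : ∀ n : ℕ+, Set (MatLevel R₁ n))
    (f : ∀ n : ℕ+, MatLevel R₁ n → MatLevel R₂ n) (n : ℕ+) (X : MatLevel R₁ n)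
    (P : MatLevel R₂ n) : Prop :=
  ∃ (p : ℕ+) (J : Matrix (Fin p) (Fin n) ℂ) (Z : MatLevel R₁ p) (Q : MatLevel R₂ p),
    Jᴴ * J = 1 ∧ Intertwines Z J X ∧ IsContinuedValue D B f p Z Q ∧ P = sandwich Jᴴ Q J

theorem IsContinuedValue.isCompressedValue {D B : ∀ n : ℕ+, Set (MatLevel R₁ n)}
    {f : ∀ n : ℕ+, MatLevel R₁ n → MatLevel R₂ n} {n : ℕ+} {X : MatLevel R₁ n}
    {P : MatLevel R₂ n} (h : IsContinuedValue D B f n X P) : IsCompressedValue D B f n X P :=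
  ⟨n, 1, X, P, by simp, Intertwines.refl X, h, by rw [conjTranspose_one, one_sandwich_one]⟩

theorem IsContinuedValue.isCompressedValue_left {D B : ∀ n : ℕ+, Set (MatLevel R₁ n)}
    {f : ∀ n : ℕ+, MatLevel R₁ n → MatLevel R₂ n} {n m : ℕ+} {X : MatLevel R₁ n}
    {Y : MatLevel R₁ m} {Q : MatLevel R₂ (n + m)}
    (h : IsContinuedValue D B f (n + m) (dirSum X Y) Q) :
    IsCompressedValue D B f n X (sandwich (inclLeft (sumEquiv n m))ᴴ Q (inclLeft (sumEquiv n m))) :=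
  ⟨n + m, inclLeft (sumEquiv n m), _, Q, inclLeft_star_mul_inclLeft _,
    intertwines_blockSum_inclLeft _ X Y, h, rfl⟩

theorem IsCompressedValue.intertwines {D B : ∀ n : ℕ+, Set (MatLevel R₁ n)} (hD : IsFreeSet D)
    (hB : IsFreeSet B) (hBopen : IsOpenFree B)
    {f : ∀ n : ℕ+, MatLevel R₁ n → MatLevel R₂ n} (hf : IsFreeAnalyticOn f B)
    (hc : ContinuesAlongPaths D B f) {n m : ℕ+} {X : MatLevel R₁ n} {X' : MatLevel R₁ m}
    {P : MatLevel R₂ n} {P' : MatLevel R₂ m} (h : IsCompressedValue D B f n X P)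
    (h' : IsCompressedValue D B f m X' P') {T : Matrix (Fin n) (Fin m) ℂ}
    (hT : T * Tᴴ * T = T) (hX : Intertwines X T X') : sandwich 1 P T = sandwich T P' 1 := by
  obtain ⟨p, J, Z, Q, hJ, hZ, hQ, rfl⟩ := h
  obtain ⟨p', J', Z', Q', hJ', hZ', hQ', rfl⟩ := h'
  -- Moving `T` up to the larger matrices by the isometries gives a partial isometry intertwining
  -- `Z` and `Z'`; compressing the resulting relation returns to `T`.
  have hTT : J * T * J'ᴴ * (J * T * J'ᴴ)ᴴ * (J * T * J'ᴴ) = J * T * J'ᴴ := by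
    calc _ = J * (T * (J'ᴴ * J') * Tᴴ * (Jᴴ * J) * T) * J'ᴴ := by
          simp only [conjTranspose_mul, conjTranspose_conjTranspose, Matrix.mul_assoc]
      _ = _ := by rw [hJ, hJ', Matrix.mul_one, Matrix.mul_one, hT]
  have key := hQ.intertwines hD hB hBopen hf hc hQ' hTT ((hZ.trans hX).trans hZ'.symm)
  have key' := congrArg (fun M => sandwich Jᴴ M J') key
  simp only [sandwich_sandwich, Matrix.mul_one, Matrix.one_mul] at key' ⊢
  rw [Matrix.mul_assoc, hJ', Matrix.mul_one, Matrix.mul_assoc, ← Matrix.mul_assoc Jᴴ, hJ,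
    Matrix.one_mul] at key'
  exact key'

/-- This is the monodromy statement: neither the path nor the ambient direct sum affects the value,
by intertwining with `T = 1`. -/
theorem IsCompressedValue.unique {D B : ∀ n : ℕ+, Set (MatLevel R₁ n)} (hD : IsFreeSet D)
    (hB : IsFreeSet B) (hBopen : IsOpenFree B)
    {f : ∀ n : ℕ+, MatLevel R₁ n → MatLevel R₂ n} (hf : IsFreeAnalyticOn f B)
    (hc : ContinuesAlongPaths D B f) {n : ℕ+} {X : MatLevel R₁ n}
    {P P' : MatLevel R₂ n} (h : IsCompressedValue D B f n X P)
    (h' : IsCompressedValue D B f n X P') : P = P' := by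
  have := h.intertwines hD hB hBopen hf hc h' (T := 1) (by simp) (Intertwines.refl X)
  rwa [one_sandwich_one, one_sandwich_one] at this

omit [TopologicalSpace R₁] [IsTopologicalAddGroup R₁] [ContinuousSMul ℂ R₁] in
theorem IsFreeSet.nonempty_mul {D : ∀ n : ℕ+, Set (MatLevel R₁ n)} (hD : IsFreeSet D) {n : ℕ+}
    (hn : (D n).Nonempty) (j : ℕ+) : (D (n * j)).Nonempty := by
  induction j using PNat.recOn with
  | one => rwa [mul_one]
  | succ j ih =>
    obtain ⟨X, hX⟩ := ih
    obtain ⟨Y, hY⟩ := hn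
    rw [mul_add, mul_one]
    exact ⟨_, hD.dirSum_mem hX hY⟩

/-- Every point of `D` has a direct sum with a point of `D` that can be joined to `B`. -/
theorem exists_path_to_dirSum {D B : ∀ n : ℕ+, Set (MatLevel R₁ n)} (hD : IsFreeSet D)
    (hDconn : IsConnectedFree D) (hB : IsFreeSet B) (hBne : ∃ n, (B n).Nonempty)
    (hBD : ∀ n, B n ⊆ D n) {n : ℕ+} {X : MatLevel R₁ n} (hX : X ∈ D n) :
    ∃ (m : ℕ+) (Y : MatLevel R₁ m) (γ : C(unitInterval, MatLevel R₁ (n + m))),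
      Y ∈ D m ∧ γ 0 ∈ B (n + m) ∧ (∀ t, γ t ∈ D (n + m)) ∧ γ 1 = dirSum X Y := by
  obtain ⟨b, hb⟩ := hBne
  -- Adding a point of level `n * k` to `X` lands on a multiple of `b`, where `B` is nonempty. The
  -- factor `2` keeps `k` positive even for `b = 1`.
  obtain ⟨k, hk⟩ : ∃ k : ℕ+, 1 + k = b * 2 := by
    refine ⟨b * 2 - 1, PNat.add_sub_of_lt ?_⟩
    rw [← PNat.coe_lt_coe, PNat.mul_coe]
    have := b.pos
    simp only [PNat.val_ofNat]
    omega
  have hnk : n + n * k = b * (2 * n) := by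
    rw [← mul_assoc, ← hk]; ring
  obtain ⟨Y, hY⟩ := hD.nonempty_mul ⟨X, hX⟩ k
  have hBn : (B (n + n * k)).Nonempty := by rw [hnk]; exact hB.nonempty_mul hb _
  obtain ⟨b₀, hb₀⟩ := hBn
  have hj := hDconn _ b₀ (hBD _ hb₀) (dirSum X Y) (hD.dirSum_mem hX hY)
  refine ⟨n * k, Y, hj.somePath.toContinuousMap, hY, ?_, fun t => hj.somePath_mem t, ?_⟩
  · have : hj.somePath.toContinuousMap 0 = b₀ := hj.somePath.source
    rwa [this]
  · exact hj.somePath.target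

theorem exists_isCompressedValue {D B : ∀ n : ℕ+, Set (MatLevel R₁ n)} (hD : IsFreeSet D)
    (hDconn : IsConnectedFree D) (hB : IsFreeSet B) (hBne : ∃ n, (B n).Nonempty)
    (hBD : ∀ n, B n ⊆ D n) {f : ∀ n : ℕ+, MatLevel R₁ n → MatLevel R₂ n}
    (hc : ContinuesAlongPaths D B f) {n : ℕ+} {X : MatLevel R₁ n} (hX : X ∈ D n) :
    ∃ P, IsCompressedValue D B f n X P := by
  obtain ⟨m, Y, γ, hY, h0, hγ, h1⟩ := exists_path_to_dirSum hD hDconn hB hBne hBD hX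
  obtain ⟨G, hG⟩ := hc _ γ h0 hγ
  have hv : IsContinuedValue D B f (n + m) (dirSum X Y) (G 1 (dirSum X Y)) :=
    ⟨γ, G, h0, hγ, hG, h1, rfl⟩
  exact ⟨_, hv.isCompressedValue_left⟩

/-- A choice of compressed values is analytic. -/
theorem isAnalyticMapOn_of_isCompressedValue {D B : ∀ n : ℕ+, Set (MatLevel R₁ n)}
    (hD : IsFreeSet D) (hDopen : IsOpenFree D) (hDconn : IsConnectedFree D) (hB : IsFreeSet B)
    (hBopen : IsOpenFree B) (hBne : ∃ n, (B n).Nonempty) (hBD : ∀ n, B n ⊆ D n)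
    {f : ∀ n : ℕ+, MatLevel R₁ n → MatLevel R₂ n} (hf : IsFreeAnalyticOn f B)
    (hc : ContinuesAlongPaths D B f) {n : ℕ+} {F : MatLevel R₁ n → MatLevel R₂ n}
    (hF : ∀ X ∈ D n, IsCompressedValue D B f n X (F X)) : IsAnalyticMapOn F (D n) := by
  refine IsAnalyticMapOn.of_locally fun X hX => ?_
  obtain ⟨m, Y, γ, hY, h0, hγ, h1⟩ := exists_path_to_dirSum hD hDconn hB hBne hBD hX
  obtain ⟨G, hG⟩ := hc _ γ h0 hγ
  obtain ⟨U, hU, h1U, hUa⟩ := hG.analytic 1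
  let e : Fin n ⊕ Fin m ≃ Fin (n + m : ℕ+) := (sumEquiv n m)
  let A : MatLevel R₁ n →L[ℂ] MatLevel R₁ (n + m) := sandwichCLM (inclLeft e) (inclLeft e)ᴴ
  let L : MatLevel R₂ (n + m) →L[ℂ] MatLevel R₂ n := sandwichCLM (inclLeft e)ᴴ (inclLeft e)
  let c : MatLevel R₁ (n + m) := sandwich (inclRight e) Y (inclRight e)ᴴ
  have hA : ∀ X', A X' + c = dirSum X' Y := fun X' => (dirSum_eq_sandwich X' Y).symm
  have hAc : Continuous fun X' => A X' + c := A.continuous.add continuous_const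
  have ht : Tendsto (fun X' => A X' + c) (𝓝 X) (𝓝 (γ 1)) := by
    rw [h1, ← hA]
    exact hAc.tendsto X
  -- The local model is the corner of the single germ `G 1` at `X' ⊕ Y` with `Y` fixed. Prolonging
  -- the path to `X' ⊕ Y` makes it a compressed value, equal to `F X'` by uniqueness.
  refine ⟨fun X' => L (G 1 (A X' + c)), _, hU.preimage hAc, ?_, hUa.clm_comp_affine L A c, ?_⟩
  · rw [Set.mem_preimage, hA, ← h1]
    exact h1U
  · filter_upwards [(hDopen n).mem_nhds hX,
      ht.eventually (hG.exists_extension (hDopen _) hγ)] with X' hX' hext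
    obtain ⟨γ', G', h0', hγ', hG', h1', hGG⟩ := hext
    rw [hA] at h1' ⊢
    have hv : IsContinuedValue D B f (n + m) (dirSum X' Y) (G 1 (dirSum X' Y)) :=
      ⟨γ', G', by rw [h0']; exact h0, hγ', hG', h1', by rw [hGG]⟩
    exact (hF X' hX').unique hD hB hBopen hf hc hv.isCompressedValue_left

/-- A choice of compressed values is a free analytic function. -/
theorem isFreeAnalyticOn_of_isCompressedValue {D B : ∀ n : ℕ+, Set (MatLevel R₁ n)}
    (hD : IsFreeSet D) (hDopen : IsOpenFree D) (hDconn : IsConnectedFree D) (hB : IsFreeSet B)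
    (hBopen : IsOpenFree B) (hBne : ∃ n, (B n).Nonempty) (hBD : ∀ n, B n ⊆ D n)
    {f : ∀ n : ℕ+, MatLevel R₁ n → MatLevel R₂ n} (hf : IsFreeAnalyticOn f B)
    (hc : ContinuesAlongPaths D B f) {F : ∀ n : ℕ+, MatLevel R₁ n → MatLevel R₂ n}
    (hF : ∀ n, ∀ X ∈ D n, IsCompressedValue D B f n X (F n X)) : IsFreeAnalyticOn F D where
  map_dirSum {n m X Y} hX hY := by
    have hXY := hF _ _ (hD.dirSum_mem hX hY)
    refine eq_blockSum_of_sandwich (sumEquiv n m)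
      (hXY.intertwines hD hB hBopen hf hc (hF _ _ hX) ?_
        (intertwines_blockSum_inclLeft (sumEquiv n m) X Y))
      (hXY.intertwines hD hB hBopen hf hc (hF _ _ hY) ?_
        (intertwines_blockSum_inclRight (sumEquiv n m) X Y))
    · exact mul_conjTranspose_mul_of_isometry (inclLeft_star_mul_inclLeft _)
    · exact mul_conjTranspose_mul_of_isometry (inclRight_star_mul_inclRight _)
  map_starConj {n X V} hX hV := by
    have hV₁ : V * Vᴴ = 1 := mem_unitaryGroup_iff.1 hV
    have hV₂ : Vᴴ * V = 1 := mem_unitaryGroup_iff'.1 hV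
    -- Here `V` itself is the intertwiner, so equivariance holds for every unitary, although the
    -- continued germs only gave it near `1`.
    have key := (hF _ _ hX).intertwines hD hB hBopen hf hc (hF _ _ (hD.starConj_mem hX hV))
      (T := V) (by rw [hV₁, Matrix.one_mul]) (intertwines_of_unitary X hV₁)
    have key' := congrArg (fun M => sandwich Vᴴ M (1 : MatLevel ℂ n)) key
    simp only [sandwich_sandwich, Matrix.mul_one, hV₂, one_sandwich_one] at key'
    exact key'.symm
  analytic n := isAnalyticMapOn_of_isCompressedValue hD hDopen hDconn hB hBopen hBne hBD hf hc
    (hF n)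

/-- Every free analytic extension of `f` takes the compressed values. -/
theorem IsFreeAnalyticOn.isCompressedValue {D B : ∀ n : ℕ+, Set (MatLevel R₁ n)}
    (hD : IsFreeSet D) (hDopen : IsOpenFree D) (hDconn : IsConnectedFree D) (hB : IsFreeSet B)
    (hBopen : IsOpenFree B) (hBne : ∃ n, (B n).Nonempty) (hBD : ∀ n, B n ⊆ D n)
    {f F : ∀ n : ℕ+, MatLevel R₁ n → MatLevel R₂ n} (hF : IsFreeAnalyticOn F D)
    (hFf : ∀ n, Set.EqOn (F n) (f n) (B n)) {n : ℕ+} {X : MatLevel R₁ n} (hX : X ∈ D n) :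
    IsCompressedValue D B f n X (F n X) := by
  obtain ⟨m, Y, γ, hY, h0, hγ, h1⟩ := exists_path_to_dirSum hD hDconn hB hBne hBD hX
  have hcont := (hF.analytic (n + m)).isContinuationAlong (hDopen _) (hBopen _) (hFf _) γ h0 hγ
  have hv : IsContinuedValue D B f (n + m) (dirSum X Y) (dirSum (F n X) (F m Y)) :=
    ⟨γ, _, h0, hγ, hcont, h1, hF.map_dirSum hX hY⟩
  have key := hv.isCompressedValue_left
  have hval : sandwich (inclLeft (sumEquiv n m))ᴴ (dirSum (F n X) (F m Y))
      (inclLeft (sumEquiv n m)) = F n X := by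
    refine (inclLeft_star_sandwich_blockSum (sumEquiv n m) _ _ _).trans ?_
    rw [inclLeft_star_mul_inclLeft, one_sandwich_one]
  rwa [hval] at key

end Continuations

/-! ### The equivalence. -/

theorem mainTheorem2 {R₁ R₂ : Type*}
    [AddCommGroup R₁] [Module ℂ R₁] [TopologicalSpace R₁] [IsTopologicalAddGroup R₁]
    [ContinuousSMul ℂ R₁]
    [AddCommGroup R₂] [Module ℂ R₂] [TopologicalSpace R₂] [IsTopologicalAddGroup R₂]
    [ContinuousSMul ℂ R₂] [SeparatingDual ℂ R₂]
    (D : ∀ n : ℕ+, Set (MatLevel R₁ n))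
    (hD : IsFreeSet D) (hDopen : IsOpenFree D) (hDconn : IsConnectedFree D)
    (B : ∀ n : ℕ+, Set (MatLevel R₁ n))
    (hB : IsFreeSet B) (hBopen : IsOpenFree B) (hBne : ∃ n, (B n).Nonempty)
    (hBD : ∀ n, B n ⊆ D n)
    (f : ∀ n : ℕ+, MatLevel R₁ n → MatLevel R₂ n) (hf : IsFreeAnalyticOn f B) :
    (∀ (n : ℕ+) (γ : C(unitInterval, MatLevel R₁ n)), γ 0 ∈ B n → (∀ t, γ t ∈ D n) →
        ∃ G, IsContinuationAlong (f n) γ G) ↔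
      ∃ F : ∀ n : ℕ+, MatLevel R₁ n → MatLevel R₂ n,
        IsFreeAnalyticOn F D ∧
        (∀ n, Set.EqOn (F n) (f n) (B n)) ∧
        (∀ F' : ∀ n : ℕ+, MatLevel R₁ n → MatLevel R₂ n, IsFreeAnalyticOn F' D →
          (∀ n, Set.EqOn (F' n) (f n) (B n)) → ∀ n, Set.EqOn (F' n) (F n) (D n)) ∧
        (∀ (n : ℕ+) (γ : C(unitInterval, MatLevel R₁ n)) (G : unitInterval → _ → _),
          γ 0 ∈ B n → (∀ t, γ t ∈ D n) → IsContinuationAlong (f n) γ G →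
            ∀ t, G t =ᶠ[𝓝 (γ t)] F n) := by
  constructor
  · intro hc
    have hex : ∀ n X, ∃ P, X ∈ D n → IsCompressedValue D B f n X P := fun n X => by
      by_cases hX : X ∈ D n
      · obtain ⟨P, hP⟩ := exists_isCompressedValue hD hDconn hB hBne hBD hc hX
        exact ⟨P, fun _ => hP⟩
      · exact ⟨0, fun h => absurd h hX⟩
    choose F hF using hex
    have hFfree : IsFreeAnalyticOn F D := isFreeAnalyticOn_of_isCompressedValue hD hDopen hDconn hB
      hBopen hBne hBD hf hc hF
    have hFf : ∀ n, Set.EqOn (F n) (f n) (B n) := fun n X hX => by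
      -- On `B` the constant path already exhibits `f n X` as a continued value.
      have hcont := (hf.analytic n).isContinuationAlong (hBopen n) (hBopen n) (fun _ _ => rfl)
        (ContinuousMap.const _ X) hX fun _ => hX
      have hv : IsContinuedValue D B f n X (f n X) :=
        ⟨_, _, hX, fun _ => hBD n hX, hcont, rfl, rfl⟩
      exact (hF n X (hBD n hX)).unique hD hB hBopen hf hc hv.isCompressedValue
    refine ⟨F, hFfree, hFf, fun F' hF' hF'f n X hX => ?_, fun n γ G h0 hγ hG t => ?_⟩
    · exact (hF'.isCompressedValue hD hDopen hDconn hB hBopen hBne hBD hF'f hX).unique hD hB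
        hBopen hf hc (hF n X hX)
    -- The constant family `F n` is itself a continuation along `γ`, so uniqueness of continuation
    -- identifies the germs; the converse implication uses the same family.
    · exact hG.eventuallyEq ((hFfree.analytic n).isContinuationAlong (hDopen n) (hBopen n)
        (hFf n) γ h0 hγ) t
  · rintro ⟨F, hF, hFf, -⟩ n γ h0 hγ
    exact ⟨_, (hF.analytic n).isContinuationAlong (hDopen n) (hBopen n) (hFf n) γ h0 hγ⟩
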